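/- Let $D$ be an $h$-local Prüfer domain with quotient field $K$; that is, $D$ is an integral domain in which every nonzero finitely generated ideal is invertible, each nonzero element of $D$ lies in only finitely many maximal ideals, and each nonzero prime ideal of $D$ lies in a unique maximal ideal. For $D$-submodules $A,B$ of $K$ put $(A:B)=\{x\in K : xB\subseteq A\}$, and put $E^v=(D:(D:E))$; thus $E^v=K$ if $E$ is nonzero and not a fractional ideal. Let $$\mathcal F^v=\{I\text{ ideal of }D : I^v=D\},\qquad \Pi^v=\{Q\in\operatorname{Spec}(D) : Q\neq 0,\ Q^v\neq D\},$$ $$\mathcal F(\Pi^v)=\{I\text{ ideal of }D : I\not\subseteq Q\text{ for every }Q\in\Pi^v\},$$ and, for each nonzero $D$-submodule $E$ of $K$, $$E^{\overline v}=\bigcup\{(E:I) : I\in\mathcal F^v\},\qquad E^{v_{sp}}=\bigcap\{ED_Q : Q\in\Pi^v\}$$ (the empty intersection being $K$). Then: (1) $\overline v=v$ on nonzero fractional ideals: $E^{\overline v}=E^v$ for every nonzero fractional ideal $E$ of $D$. (2) The following statements are equivalent: (i) $v$ is quasi-spectral: for each nonzero ideal $I$ of $D$ with $I^v\neq D$ there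 is a prime ideal $Q$ of $D$ with $I\subseteq Q$ and $Q=Q^v$; (ii) $v_{sp}\le v$, i.e. $E^{v_{sp}}\subseteq E^v$ for every nonzero $D$-submodule $E$ of $K$; (iii) $D=\bigcap\{D_Q : Q\in\operatorname{Spec}(D),\ Q=Q^v\}$ (the empty intersection being $K$); (iv) $\overline v=v_{sp}=v$, i.e. $E^{\overline v}=E^{v_{sp}}$ for every nonzero $D$-submodule $E$ of $K$, and $E^{v_{sp}}=E^v$ for every nonzero fractional ideal $E$ of $D$; (v) $\mathcal F^v=\mathcal F(\Pi^v)$. -/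

import Mathlib

open scoped nonZeroDivisors

/-- A Prüfer domain: every nonzero finitely generated ideal is invertible. -/
def IsPruferDomain (D : Type*) [CommRing D] [IsDomain D] : Prop :=
  ∀ I : Ideal D, I.FG → I ≠ ⊥ → IsUnit (I : FractionalIdeal D⁰ (FractionRing D))

/-- An `h`-local domain: finite character, and each nonzero prime ideal lies in a unique
maximal ideal. -/
structure IsHLocal (D : Type*) [CommRing D] [IsDomain D] : Prop where
  finite_character : ∀ x : D, x ≠ 0 → {M : Ideal D | M.IsMaximal ∧ x ∈ M}.Finite
  existsUnique_maximal : ∀ P : Ideal D, P.IsPrime → P ≠ ⊥ → ∃! M : Ideal D, M.IsMaximal ∧ P ≤ M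

namespace Semistar

set_option linter.unusedSectionVars false

variable {D : Type*} [CommRing D] [IsDomain D]
variable (K : Type*) [Field K] [Algebra D K] [IsFractionRing D K]

/-- An ideal of `D`, regarded as a `D`-submodule of the quotient field `K`. -/
abbrev ofIdeal (I : Ideal D) : Submodule D K := IsLocalization.coeSubmodule K I

/-- Membership in the set of all nonzero fractional ideals of `D`. -/
def IsNonzeroFractional {K : Type*} [Field K] [Algebra D K] (E : Submodule D K) : Prop :=
  E ≠ ⊥ ∧ IsFractional D⁰ E

/-- The `v`-operation `E ↦ (D : (D : E))`. For submodules `A`, `B` of `K`, the quotient `A / B` is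
`(A : B) = {x ∈ K | x B ⊆ A}`, and `1` is `D` inside `K`. -/
def vOp {K : Type*} [Field K] [Algebra D K] (E : Submodule D K) : Submodule D K :=
  1 / (1 / E)

/-- The localizing system associated to the `v`-operation: the ideals `I` with `I^v = D`. -/
def localizingSystemV : Set (Ideal D) := {I | vOp (ofIdeal K I) = 1}

/-- The set of nonzero prime ideals `Q` with `Q^v ≠ D`. -/
def primesV : Set (PrimeSpectrum D) :=
  {Q | vOp (ofIdeal K Q.asIdeal) ≠ 1 ∧ Q.asIdeal ≠ ⊥}

/-- The set of ideals contained in no member of a set `Δ` of primes. -/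
def localizingSystemOfPrimes (Δ : Set (PrimeSpectrum D)) : Set (Ideal D) :=
  {I | ∀ Q ∈ Δ, ¬ I ≤ Q.asIdeal}

/-- The localization `D_Q`, as a `D`-submodule of `K`. -/
noncomputable def localizationAt (Q : PrimeSpectrum D) : Submodule D K :=
  Subalgebra.toSubmodule (Localization.subalgebra.ofField K Q.asIdeal.primeCompl
    Q.asIdeal.primeCompl_le_nonZeroDivisors)

variable {K}

theorem one_div_eq_one_of_mem {I : Ideal D} (h : I ∈ localizingSystemV K) :
    (1 : Submodule D K) / ofIdeal K I = 1 := by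
  have h' : (1 : Submodule D K) / (1 / ofIdeal K I) = 1 := h
  apply le_antisymm
  · intro x hx
    have h1 : (1 : K) ∈ (1 : Submodule D K) / (1 / ofIdeal K I) := by
      rw [h']; exact Submodule.one_le.mp le_rfl
    simpa using Submodule.mem_div_iff_forall_mul_mem.mp h1 x hx
  · rw [Submodule.le_div_iff_mul_le, one_mul]
    rintro x ⟨y, -, rfl⟩
    exact Submodule.mem_one.mpr ⟨y, rfl⟩

theorem mem_of_one_div_eq_one {I : Ideal D} (h : (1 : Submodule D K) / ofIdeal K I = 1) :
    I ∈ localizingSystemV K := by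
  change (1 : Submodule D K) / (1 / ofIdeal K I) = 1
  rw [h]
  apply le_antisymm
  · intro x hx
    simpa using Submodule.mem_div_iff_forall_mul_mem.mp hx 1 (Submodule.one_le.mp le_rfl)
  · rw [Submodule.le_div_iff_mul_le, one_mul]

theorem mul_mem_localizingSystemV {I J : Ideal D} (hI : I ∈ localizingSystemV K)
    (hJ : J ∈ localizingSystemV K) : I * J ∈ localizingSystemV K := by
  apply mem_of_one_div_eq_one
  have hI' := one_div_eq_one_of_mem hI
  have hJ' := one_div_eq_one_of_mem hJ
  apply le_antisymm
  · refine le_trans (b := (1 / ofIdeal K J) / ofIdeal K I) ?_ (by rw [hJ', hI'])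
    rw [Submodule.le_div_iff_mul_le, Submodule.le_div_iff_mul_le, mul_assoc,
      ← IsLocalization.coeSubmodule_mul, ← Submodule.le_div_iff_mul_le]
  · rw [Submodule.le_div_iff_mul_le, one_mul]
    rintro x ⟨y, -, rfl⟩
    exact Submodule.mem_one.mpr ⟨y, rfl⟩

theorem top_mem_localizingSystemV : (⊤ : Ideal D) ∈ localizingSystemV K := by
  apply mem_of_one_div_eq_one
  rw [ofIdeal, IsLocalization.coeSubmodule_top]
  apply le_antisymm
  · intro x hx
    simpa using Submodule.mem_div_iff_forall_mul_mem.mp hx 1 (Submodule.one_le.mp le_rfl)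
  · rw [Submodule.le_div_iff_mul_le, one_mul]

/-- The operation `v̄`: `E ↦ ⋃ {(E : I) | I in the localizing system of v}`. -/
def vBar (E : Submodule D K) : Submodule D K where
  carrier := ⋃ I ∈ localizingSystemV (D := D) K, ((E / ofIdeal K I : Submodule D K) : Set K)
  zero_mem' := by
    simp only [Set.mem_iUnion]
    exact ⟨⊤, top_mem_localizingSystemV, Submodule.zero_mem _⟩
  add_mem' := by
    intro x y hx hy
    simp only [Set.mem_iUnion, SetLike.mem_coe] at hx hy ⊢
    obtain ⟨I, hI, hx⟩ := hx
    obtain ⟨J, hJ, hy⟩ := hy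
    refine ⟨I * J, mul_mem_localizingSystemV hI hJ, Submodule.add_mem _ ?_ ?_⟩
    · rw [Submodule.mem_div_iff_forall_mul_mem] at hx ⊢
      rintro _ ⟨z, hz, rfl⟩
      exact hx _ ⟨z, Ideal.mul_le_left hz, rfl⟩
    · rw [Submodule.mem_div_iff_forall_mul_mem] at hy ⊢
      rintro _ ⟨z, hz, rfl⟩
      exact hy _ ⟨z, Ideal.mul_le_right hz, rfl⟩
  smul_mem' := by
    intro c x hx
    simp only [Set.mem_iUnion, SetLike.mem_coe] at hx ⊢
    obtain ⟨I, hI, hx⟩ := hx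
    exact ⟨I, hI, Submodule.smul_mem _ c hx⟩

/-- The operation `v_sp`: `E ↦ ⋂ {E D_Q | Q nonzero prime, Q^v ≠ D}`, with the empty intersection
being `K`. -/
noncomputable def vSp (E : Submodule D K) : Submodule D K :=
  ⨅ Q ∈ primesV (D := D) K, E * localizationAt K Q

/-- The `v`-operation is quasi-spectral: each nonzero ideal `I` with `I^v ≠ D` is contained in a
prime ideal `Q` with `Q = Q^v`. -/
def QuasiSpectralV (D : Type*) [CommRing D] [IsDomain D]
    (K : Type*) [Field K] [Algebra D K] [IsFractionRing D K] : Prop :=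
  ∀ I : Ideal D, I ≠ ⊥ → vOp (ofIdeal K I) ≠ 1 →
    ∃ Q : PrimeSpectrum D, I ≤ Q.asIdeal ∧ ofIdeal K Q.asIdeal = vOp (ofIdeal K Q.asIdeal)

end Semistar

namespace Semistar

set_option linter.unusedSectionVars false

/-! Everything rests on one fact: if `E` is fractional and `x ∈ E^v`, then `I = (E :_D x)` satisfies
`(D : I) = D`. Otherwise some `y ∈ (D : I)` lies outside `D_M` for a maximal `M`. The Prüfer
condition makes `x` and each `e ∈ E` comparable at `M`, which forces `y x⁻¹ E ⊆ D_M`. By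
`h`-locality (`exists_common_denominator`) one `s ∉ M` gives `s y x⁻¹ ∈ (D : E)`, so `s y ∈ D`, a
contradiction. This yields (1), and also that primes with `Q^v ≠ D` are divisorial. Part (2) then
compares ideals `(E :_D x)` with the primes in `Π^v`. -/

theorem exists_mul_mem_span_singleton {D : Type*} [CommRing D] [IsDomain D] (hH : IsHLocal D)
    {M N : Ideal D} (hM : M.IsMaximal) (hN : N.IsMaximal) (hMN : M ≠ N) {t : D} (ht : t ≠ 0) :
    ∃ u ∉ N, ∃ v ∉ M, u * v ∈ Ideal.span {t} := by
  by_contra! hcon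
  have := hM.isPrime
  have := hN.isPrime
  -- Otherwise a prime containing `t` misses both complements, so this nonzero prime lies in both
  -- `M` and `N`.
  have hdisj : Disjoint (Ideal.span {t} : Set D) (N.primeCompl ⊔ M.primeCompl : Submonoid D) := by
    rw [Set.disjoint_left]
    intro x hx hxS
    obtain ⟨u, hu, v, hv, rfl⟩ := Submonoid.mem_sup.mp hxS
    exact hcon u hu v hv hx
  obtain ⟨P, hP, htP, hPS⟩ := Ideal.exists_le_prime_disjoint _ _ hdisj
  have hP0 : P ≠ ⊥ := by
    rintro rfl
    exact ht (by simpa using htP)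
  rw [Set.disjoint_left] at hPS
  refine hMN ((hH.existsUnique_maximal P hP hP0).unique ⟨hM, ?_⟩ ⟨hN, ?_⟩)
  · intro x hx
    by_contra hxM
    exact hPS hx ((le_sup_right : M.primeCompl ≤ N.primeCompl ⊔ M.primeCompl) hxM)
  · intro x hx
    by_contra hxN
    exact hPS hx ((le_sup_left : N.primeCompl ≤ N.primeCompl ⊔ M.primeCompl) hxN)

/-- In a Prüfer domain, any two elements are comparable under divisibility locally at `M`. -/
theorem _root_.IsPruferDomain.exists_mul_eq {D : Type*} [CommRing D] [IsDomain D]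
    (hP : IsPruferDomain D) {M : Ideal D} (hM : M.IsMaximal) (a b : D) :
    ∃ s ∉ M, ∃ c, s * a = c * b ∨ s * b = c * a := by
  by_cases h0 : Ideal.span {a} ⊔ Ideal.span {b} = ⊥
  · have hb : b = 0 := by
      rw [sup_eq_bot_iff] at h0
      simpa using h0.2
    exact ⟨1, (Ideal.ne_top_iff_one M).mp hM.ne_top, 0, Or.inr (by simp [hb])⟩
  obtain ⟨J, hJ⟩ := (hP (Ideal.span {a} ⊔ Ideal.span {b})
    ((Submodule.fg_span_singleton a).sup (Submodule.fg_span_singleton b)) h0).exists_right_inv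
  rw [FractionalIdeal.coeIdeal_sup, FractionalIdeal.coeIdeal_span_singleton,
    FractionalIdeal.coeIdeal_span_singleton, add_mul] at hJ
  set F := FractionRing D
  have hinj : Function.Injective (algebraMap D F) := IsFractionRing.injective D F
  have key : ∀ j ∈ J, (∃ r, algebraMap D F r = algebraMap D F a * j) ∧
      ∃ r, algebraMap D F r = algebraMap D F b * j := by
    intro j hj
    constructor <;> rw [← FractionalIdeal.mem_one_iff D⁰, ← hJ, FractionalIdeal.mem_add]
    · exact ⟨_, FractionalIdeal.mem_singleton_mul.mpr ⟨j, hj, rfl⟩, 0,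
        FractionalIdeal.zero_mem _, add_zero _⟩
    · exact ⟨0, FractionalIdeal.zero_mem _, _,
        FractionalIdeal.mem_singleton_mul.mpr ⟨j, hj, rfl⟩, zero_add _⟩
  have h1 : (1 : F) ∈ (1 : FractionalIdeal D⁰ F) := FractionalIdeal.one_mem_one _
  rw [← hJ, FractionalIdeal.mem_add] at h1
  obtain ⟨x, hx, y, hy, hxy⟩ := h1
  obtain ⟨i, hi, rfl⟩ := FractionalIdeal.mem_singleton_mul.mp hx
  obtain ⟨j, hj, rfl⟩ := FractionalIdeal.mem_singleton_mul.mp hy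
  obtain ⟨⟨p, hp⟩, q, hq⟩ := key i hi
  obtain ⟨⟨p', hp'⟩, q', hq'⟩ := key j hj
  -- `p = a i` and `q' = b j` sum to `1` in `D`, so one of them avoids `M` and serves as the
  -- multiplier.
  have hsum : p + q' = 1 := by
    apply hinj
    rw [map_add, hp, hq', hxy, map_one]
  by_cases hpM : p ∈ M
  · refine ⟨q', fun hqM => hM.ne_top ((Ideal.eq_top_iff_one M).mpr
      (hsum ▸ M.add_mem hpM hqM)), p', Or.inl (hinj ?_)⟩
    rw [map_mul, map_mul, hp', hq']
    ring
  · refine ⟨p, hpM, q, Or.inr (hinj ?_)⟩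
    rw [map_mul, map_mul, hp, hq]
    ring

variable {D : Type*} [CommRing D] [IsDomain D]
variable {K : Type*} [Field K] [Algebra D K] [IsFractionRing D K]

/-! ### Localizations inside `K` and common denominators -/

theorem algebraMap_ne_zero_of_notMem {I : Ideal D} {s : D} (hs : s ∉ I) : algebraMap D K s ≠ 0 :=
  (map_ne_zero_iff _ (IsFractionRing.injective D K)).mpr fun h => hs (h ▸ I.zero_mem)

theorem mem_mul_localizationAt {Q : PrimeSpectrum D} {E : Submodule D K} {x : K} :
    x ∈ E * localizationAt K Q ↔ ∃ s ∉ Q.asIdeal, s • x ∈ E := by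
  constructor
  · intro hx
    induction hx using Submodule.mul_induction_on' with
    | mem_mul_mem e he l hl =>
      obtain ⟨a, s, hs, rfl⟩ := hl
      refine ⟨s, hs, ?_⟩
      have hs0 := algebraMap_ne_zero_of_notMem (K := K) hs
      convert E.smul_mem a he using 1
      rw [Algebra.smul_def, Algebra.smul_def]
      field_simp
    | add x _ y _ hx hy =>
      obtain ⟨s, hs, hx⟩ := hx
      obtain ⟨t, ht, hy⟩ := hy
      refine ⟨s * t, Q.asIdeal.primeCompl.mul_mem hs ht, ?_⟩
      rw [smul_add]
      refine E.add_mem ?_ ?_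
      · rw [mul_comm, mul_smul]
        exact E.smul_mem t hx
      · rw [mul_smul]
        exact E.smul_mem s hy
  · rintro ⟨s, hs, hx⟩
    have hs0 := algebraMap_ne_zero_of_notMem (K := K) hs
    have hl : algebraMap D K 1 * (algebraMap D K s)⁻¹ ∈ localizationAt K Q := ⟨1, s, hs, rfl⟩
    convert Submodule.mul_mem_mul hx hl using 1
    rw [Algebra.smul_def, map_one]
    field_simp

theorem mem_localizationAt {Q : PrimeSpectrum D} {x : K} :
    x ∈ localizationAt K Q ↔ ∃ s ∉ Q.asIdeal, s • x ∈ (1 : Submodule D K) := by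
  rw [← mem_mul_localizationAt, one_mul]

theorem mem_one_of_forall_isMaximal {x : K}
    (h : ∀ M : Ideal D, M.IsMaximal → ∃ s ∉ M, s • x ∈ (1 : Submodule D K)) :
    x ∈ (1 : Submodule D K) := by
  let I : Ideal D := (1 : Submodule D K).comap (LinearMap.toSpanSingleton D K x)
  have hI : I = ⊤ := by
    by_contra hI
    obtain ⟨M, hM, hIM⟩ := Ideal.exists_le_maximal I hI
    obtain ⟨s, hs, hsx⟩ := h M hM
    exact hs (hIM hsx)
  have h1 : (1 : D) ∈ I := hI ▸ Submodule.mem_top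
  have h2 : (1 : D) • x ∈ (1 : Submodule D K) := h1
  rwa [one_smul] at h2

/-- In an `h`-local domain, elements of `D_M` with a common nonzero denominator have a common
denominator outside `M`. -/
theorem exists_common_denominator (hH : IsHLocal D) {M : Ideal D} (hM : M.IsMaximal) {t : D}
    (ht : t ≠ 0) : ∃ s ∉ M, ∀ x : K, t • x ∈ (1 : Submodule D K) →
      (∃ r ∉ M, r • x ∈ (1 : Submodule D K)) → s • x ∈ (1 : Submodule D K) := by
  classical
  have hfin := hH.finite_character t ht
  have hex : ∀ N : Ideal D, ∃ v ∉ M, N.IsMaximal → M ≠ N → ∃ u ∉ N, u * v ∈ Ideal.span {t} := by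
    intro N
    by_cases hN : N.IsMaximal ∧ M ≠ N
    · obtain ⟨u, hu, v, hv, huv⟩ := exists_mul_mem_span_singleton hH hM hN.1 hN.2 ht
      exact ⟨v, hv, fun _ _ => ⟨u, hu, huv⟩⟩
    · exact ⟨1, (Ideal.ne_top_iff_one M).mp hM.ne_top, fun h1 h2 => (hN ⟨h1, h2⟩).elim⟩
  choose v hv huv using hex
  have := hM.isPrime
  -- Integrality is checked at each maximal `N`: use `r` if `N = M`, `t` if `t ∉ N`, and otherwise
  -- the factor `v N`, for which `u * v N` is a multiple of `t` with `u ∉ N`.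
  refine ⟨∏ N ∈ hfin.toFinset, v N, M.primeCompl.prod_mem fun N _ => hv N, ?_⟩
  rintro x htx ⟨r, hr, hrx⟩
  refine mem_one_of_forall_isMaximal fun N hN => ?_
  by_cases hMN : M = N
  · subst hMN
    refine ⟨r, hr, ?_⟩
    rw [smul_comm]
    exact Submodule.smul_mem _ _ hrx
  by_cases htN : t ∈ N
  · obtain ⟨u, hu, hut⟩ := huv N hN hMN
    obtain ⟨c, hc⟩ := Ideal.mem_span_singleton'.mp hut
    refine ⟨u, hu, ?_⟩
    rw [← Finset.mul_prod_erase _ v (hfin.mem_toFinset.mpr ⟨hN, htN⟩), ← mul_smul, ← mul_assoc,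
      ← hc, mul_right_comm, mul_smul]
    exact Submodule.smul_mem _ _ htx
  · refine ⟨t, htN, ?_⟩
    rw [smul_comm]
    exact Submodule.smul_mem _ _ htx

theorem _root_.IsPruferDomain.exists_smul_eq (hP : IsPruferDomain D) {M : Ideal D}
    (hM : M.IsMaximal) (x y : K) : ∃ s ∉ M, ∃ c : D, s • x = c • y ∨ s • y = c • x := by
  classical
  obtain ⟨d, h⟩ := IsLocalization.exist_integer_multiples_of_finset D⁰ ({x, y} : Finset K)
  obtain ⟨a, ha⟩ := h x (by simp)
  obtain ⟨b, hb⟩ := h y (by simp)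
  have hd : algebraMap D K d ≠ 0 :=
    (map_ne_zero_iff _ (IsFractionRing.injective D K)).mpr (nonZeroDivisors.coe_ne_zero d)
  rw [Algebra.smul_def] at ha hb
  obtain ⟨s, hs, c, h | h⟩ := hP.exists_mul_eq hM a b
  all_goals
    have h' := congrArg (algebraMap D K) h
    rw [map_mul, map_mul, ha, hb] at h'
    refine ⟨s, hs, c, ?_⟩
    simp only [Algebra.smul_def]
  · exact Or.inl (mul_left_cancel₀ hd (by linear_combination h'))
  · exact Or.inr (mul_left_cancel₀ hd (by linear_combination h'))

/-! ### The operations `v` and `v̄` on fractional ideals -/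

theorem mem_vOp {E : Submodule D K} {x : K} :
    x ∈ vOp E ↔ ∀ w : K, (∀ e ∈ E, w * e ∈ (1 : Submodule D K)) →
      x * w ∈ (1 : Submodule D K) :=
  Iff.rfl

theorem le_vOp (E : Submodule D K) : E ≤ vOp E := by
  intro x hx
  rw [mem_vOp]
  intro w hw
  rw [mul_comm]
  exact hw x hx

theorem vOp_mono {E F : Submodule D K} (h : E ≤ F) : vOp E ≤ vOp F :=
  fun _ hx w hw => hx w fun e he => hw e (h he)

theorem vOp_one : vOp (1 : Submodule D K) = 1 := by
  refine le_antisymm (fun x hx => ?_) (le_vOp 1)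
  simpa using mem_vOp.mp hx 1 fun e he => by simpa using he

theorem ofIdeal_le_one (I : Ideal D) : ofIdeal K I ≤ 1 := by
  rintro x ⟨y, -, rfl⟩
  exact Submodule.mem_one.mpr ⟨y, rfl⟩

theorem vOp_ofIdeal_le_one (I : Ideal D) : vOp (ofIdeal K I) ≤ 1 :=
  (vOp_mono (ofIdeal_le_one I)).trans vOp_one.le

theorem vOp_ofIdeal_eq_one_iff {I : Ideal D} : vOp (ofIdeal K I) = 1 ↔ 1 ∈ vOp (ofIdeal K I) :=
  ⟨fun h => h ▸ Submodule.one_le.mp le_rfl, fun h =>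
    le_antisymm (vOp_ofIdeal_le_one I) (Submodule.one_le.mpr h)⟩

theorem mem_div_ofIdeal {E : Submodule D K} {I : Ideal D} {x : K} :
    x ∈ E / ofIdeal K I ↔ ∀ d ∈ I, d • x ∈ E := by
  rw [Submodule.mem_div_iff_forall_mul_mem]
  constructor
  · intro h d hd
    rw [Algebra.smul_def, mul_comm]
    exact h _ ⟨d, hd, rfl⟩
  · rintro h _ ⟨d, hd, rfl⟩
    have := h d hd
    rwa [Algebra.smul_def, mul_comm] at this

theorem mem_vBar {E : Submodule D K} {x : K} :
    x ∈ vBar E ↔ ∃ I ∈ localizingSystemV (D := D) K, ∀ d ∈ I, d • x ∈ E := by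
  change x ∈ ⋃ I ∈ localizingSystemV (D := D) K, ((E / ofIdeal K I : Submodule D K) : Set K) ↔ _
  simp only [Set.mem_iUnion, SetLike.mem_coe, mem_div_ofIdeal, exists_prop]

/-- The ideal `(E :_D x)`. -/
def colon (E : Submodule D K) (x : K) : Ideal D := E.comap (LinearMap.toSpanSingleton D K x)

theorem mem_colon {E : Submodule D K} {x : K} {d : D} : d ∈ colon E x ↔ d • x ∈ E :=
  Iff.rfl

theorem vBar_le_vOp (E : Submodule D K) : vBar E ≤ vOp E := by
  intro x hx
  obtain ⟨I, hI, h⟩ := mem_vBar.mp hx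
  rw [mem_vOp]
  intro w hw
  rw [← one_div_eq_one_of_mem hI, mem_div_ofIdeal]
  intro d hd
  rw [mul_comm, ← mul_smul_comm]
  exact hw _ (h d hd)

/-- The key step: `(E :_D x)^v = D` for `x ∈ E^v`. -/
theorem colon_mem_localizingSystemV (hP : IsPruferDomain D) (hH : IsHLocal D)
    {E : Submodule D K} (hE : IsFractional D⁰ E) {x : K} (hx : x ∈ vOp E) :
    colon E x ∈ localizingSystemV K := by
  apply mem_of_one_div_eq_one
  refine le_antisymm (fun y hy => ?_) ?_
  · rw [mem_div_ofIdeal] at hy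
    by_contra hy1
    have hx0 : x ≠ 0 := by
      rintro rfl
      exact hy1 (by simpa using hy 1 (mem_colon.mpr (by simp)))
    have hy0 : y ≠ 0 := by
      rintro rfl
      exact hy1 (Submodule.zero_mem _)
    obtain ⟨M, hM, hyM⟩ : ∃ M : Ideal D, M.IsMaximal ∧ ∀ s ∉ M, s • y ∉ (1 : Submodule D K) := by
      by_contra! hcon
      exact hy1 (mem_one_of_forall_isMaximal hcon)
    have := hM.isPrime
    -- `y x⁻¹ E` is contained in `D_M`
    have hloc : ∀ e ∈ E, ∃ r ∉ M, r • (y * x⁻¹ * e) ∈ (1 : Submodule D K) := by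
      intro e he
      -- In the first case `c x ∈ E`, so `c y ∈ D`. In the second `s x ∈ E`, so `s y ∈ D`, against
      -- the choice of `M`.
      obtain ⟨s, hs, c, h | h⟩ := hP.exists_smul_eq hM e x
      · refine ⟨s, hs, ?_⟩
        have hc : c • y ∈ (1 : Submodule D K) := hy c (mem_colon.mpr (h ▸ E.smul_mem s he))
        convert hc using 1
        rw [Algebra.smul_def, Algebra.smul_def] at *
        field_simp
        linear_combination h
      · exact (hyM s hs (hy s (mem_colon.mpr (h ▸ E.smul_mem c he)))).elim
    obtain ⟨a, ha, haE⟩ := hE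
    obtain ⟨b, c, hc, hbc⟩ := IsFractionRing.div_surjective (A := D) (y * x⁻¹)
    have hc0 : algebraMap D K c ≠ 0 :=
      (map_ne_zero_iff _ (IsFractionRing.injective D K)).mpr (nonZeroDivisors.ne_zero hc)
    -- `a` clears the denominators of `E` and `c` that of `y x⁻¹`.
    obtain ⟨s, hs, hsE⟩ := exists_common_denominator (K := K) hH hM
      (mul_ne_zero (nonZeroDivisors.ne_zero ha) (nonZeroDivisors.ne_zero hc))
    refine hyM s hs ?_
    have := mem_vOp.mp hx (s • (y * x⁻¹)) fun e he => by
      rw [smul_mul_assoc]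
      refine hsE _ ?_ (hloc e he)
      obtain ⟨f, hf⟩ := haE e he
      refine Submodule.mem_one.mpr ⟨b * f, ?_⟩
      rw [map_mul, hf, ← hbc]
      simp only [Algebra.smul_def, map_mul]
      field_simp
    convert this using 1
    rw [Algebra.smul_def, Algebra.smul_def]
    field_simp
  · rw [Submodule.le_div_iff_mul_le, one_mul]
    exact ofIdeal_le_one _

theorem vBar_eq_vOp (hP : IsPruferDomain D) (hH : IsHLocal D) {E : Submodule D K}
    (hE : IsFractional D⁰ E) : vBar E = vOp E :=
  le_antisymm (vBar_le_vOp E) fun _ hx =>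
    mem_vBar.mpr ⟨_, colon_mem_localizingSystemV hP hH hE hx, fun _ hd => hd⟩

theorem algebraMap_mem_ofIdeal {I : Ideal D} {d : D} : algebraMap D K d ∈ ofIdeal K I ↔ d ∈ I :=
  (IsLocalization.mem_coeSubmodule K I).trans ⟨fun ⟨_, hy, h⟩ =>
    IsFractionRing.injective D K h ▸ hy, fun h => ⟨d, h, rfl⟩⟩

theorem ofIdeal_isFractional (I : Ideal D) : IsFractional D⁰ (ofIdeal K I) :=
  FractionalIdeal.isFractional_of_le_one _ (ofIdeal_le_one I)

/-- A prime ideal `Q` with `Q^v ≠ D` is divisorial. -/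
theorem ofIdeal_eq_vOp_of_vOp_ne_one (hP : IsPruferDomain D) (hH : IsHLocal D)
    {Q : PrimeSpectrum D} (hQ : vOp (ofIdeal K Q.asIdeal) ≠ 1) :
    ofIdeal K Q.asIdeal = vOp (ofIdeal K Q.asIdeal) := by
  refine le_antisymm (le_vOp _) fun x hx => ?_
  obtain ⟨z, rfl⟩ := Submodule.mem_one.mp (vOp_ofIdeal_le_one _ hx)
  by_contra hz
  rw [algebraMap_mem_ofIdeal] at hz
  have hI := colon_mem_localizingSystemV hP hH (ofIdeal_isFractional Q.asIdeal) hx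
  refine hQ (le_antisymm (vOp_ofIdeal_le_one _) ?_)
  -- Since `z ∉ Q`, primality gives `(Q :_D z) ⊆ Q`, and the smaller ideal already has `v`-closure
  -- `D`.
  rw [← show vOp (ofIdeal K (colon (ofIdeal K Q.asIdeal) (algebraMap D K z))) = 1 from hI]
  refine vOp_mono (IsLocalization.coeSubmodule_mono K fun d hd => ?_)
  rw [mem_colon, Algebra.smul_def, ← map_mul, algebraMap_mem_ofIdeal] at hd
  exact (Q.isPrime.mem_or_mem hd).resolve_right hz

theorem vOp_ne_one_of_ofIdeal_eq_vOp {Q : PrimeSpectrum D}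
    (hQ : ofIdeal K Q.asIdeal = vOp (ofIdeal K Q.asIdeal)) : vOp (ofIdeal K Q.asIdeal) ≠ 1 := by
  rw [← hQ]
  intro h
  have h1 : algebraMap D K 1 ∈ ofIdeal K Q.asIdeal := by
    rw [h, map_one]
    exact Submodule.one_le.mp le_rfl
  exact Q.isPrime.ne_top ((Ideal.eq_top_iff_one _).mpr (algebraMap_mem_ofIdeal.mp h1))

/-! ### The spectral operation and the equivalences -/

theorem mem_vSp {E : Submodule D K} {x : K} :
    x ∈ vSp E ↔ ∀ Q ∈ primesV (D := D) K, ∃ s ∉ Q.asIdeal, s • x ∈ E := by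
  simp only [vSp, Submodule.mem_iInf, mem_mul_localizationAt]

/-- Both memberships say that `(E :_D x)` is large: it contains a member of `F^v`, or it lies in no
prime of `Π^v`. -/
theorem vBar_eq_vSp (h : localizingSystemV K = localizingSystemOfPrimes (primesV (D := D) K))
    (E : Submodule D K) : vBar E = vSp E := by
  ext x
  rw [mem_vBar, mem_vSp, h]
  constructor
  · rintro ⟨I, hI, hx⟩ Q hQ
    obtain ⟨s, hs, hsQ⟩ := SetLike.not_le_iff_exists.mp (hI Q hQ)
    exact ⟨s, hsQ, hx s hs⟩
  · intro hx
    refine ⟨colon E x, fun Q hQ hle => ?_, fun _ hd => hd⟩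
    obtain ⟨s, hs, hsx⟩ := hx Q hQ
    exact hs (hle hsx)

theorem localizingSystemV_subset :
    localizingSystemV K ⊆ localizingSystemOfPrimes (primesV (D := D) K) := by
  intro I hI Q hQ hIQ
  refine hQ.1 (le_antisymm (vOp_ofIdeal_le_one _) ?_)
  rw [← show vOp (ofIdeal K I) = 1 from hI]
  exact vOp_mono (IsLocalization.coeSubmodule_mono K hIQ)

theorem vOp_ofIdeal_span_singleton_ne_one {a : D} (ha0 : a ≠ 0) (ha : ¬ IsUnit a) :
    vOp (ofIdeal K (Ideal.span {a})) ≠ 1 := by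
  rw [Ne, vOp_ofIdeal_eq_one_iff, mem_vOp]
  intro h
  have ha0' : algebraMap D K a ≠ 0 := (map_ne_zero_iff _ (IsFractionRing.injective D K)).mpr ha0
  have h1 := h (algebraMap D K a)⁻¹ fun e he => by
    obtain ⟨y, hy, rfl⟩ := he
    obtain ⟨c, rfl⟩ := Ideal.mem_span_singleton'.mp hy
    refine Submodule.mem_one.mpr ⟨c, ?_⟩
    rw [Algebra.linearMap_apply, map_mul]
    field_simp
  obtain ⟨r, hr⟩ := Submodule.mem_one.mp h1
  rw [one_mul] at hr
  refine ha (.of_mul_eq_one r (IsFractionRing.injective D K ?_))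
  rw [map_mul, hr, mul_inv_cancel₀ ha0', map_one]

theorem QuasiSpectralV.localizingSystemV_eq (h : QuasiSpectralV D K) :
    localizingSystemV K = localizingSystemOfPrimes (primesV (D := D) K) := by
  refine localizingSystemV_subset.antisymm fun I hI => ?_
  by_contra hIv
  -- Quasi-spectrality covers only nonzero ideals. The zero ideal is replaced by a proper nonzero
  -- principal one; over a field its `v`-closure is already `D`.
  obtain ⟨J, hJ0, hIJ, hJv⟩ : ∃ J : Ideal D, J ≠ ⊥ ∧ I ≤ J ∧ vOp (ofIdeal K J) ≠ 1 := by
    by_cases hI0 : I = ⊥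
    · subst hI0
      by_cases hD : IsField D
      · refine (hIv (vOp_ofIdeal_eq_one_iff.mpr (mem_vOp.mpr fun w _ => ?_))).elim
        obtain ⟨r, hr⟩ := hD.localization_map_bijective (Rₘ := K) (M := D⁰) (by simp) |>.2 w
        exact Submodule.mem_one.mpr ⟨r, by rw [hr, one_mul]⟩
      · obtain ⟨a, ha0, ha⟩ := Ring.exists_not_isUnit_of_not_isField hD
        exact ⟨Ideal.span {a}, by simpa using ha0, bot_le,
          vOp_ofIdeal_span_singleton_ne_one ha0 ha⟩
    · exact ⟨I, hI0, le_rfl, hIv⟩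
  obtain ⟨Q, hJQ, hQ⟩ := h J hJ0 hJv
  exact hI Q ⟨vOp_ne_one_of_ofIdeal_eq_vOp hQ, ne_bot_of_le_ne_bot hJ0 hJQ⟩ (hIJ.trans hJQ)

theorem vSp_le_vOp_of_one_eq (h : (1 : Submodule D K) =
      ⨅ Q ∈ {Q : PrimeSpectrum D | ofIdeal K Q.asIdeal = vOp (ofIdeal K Q.asIdeal)},
        localizationAt K Q) (E : Submodule D K) : vSp E ≤ vOp E := by
  intro x hx
  rw [mem_vSp] at hx
  rw [mem_vOp]
  intro w hw
  rw [h]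
  simp only [Submodule.mem_iInf, mem_localizationAt]
  intro Q hQ
  -- The zero prime may occur in the intersection for `D` but not in `Π^v`; it is harmless because
  -- its localization is `K`.
  by_cases hQ0 : Q.asIdeal = ⊥
  · obtain ⟨⟨a, s⟩, hs⟩ := IsLocalization.surj D⁰ (x * w)
    refine ⟨s, by simp [hQ0], Submodule.mem_one.mpr ⟨a, ?_⟩⟩
    rw [Algebra.smul_def, mul_comm, hs]
  · obtain ⟨s, hs, hsx⟩ := hx Q ⟨vOp_ne_one_of_ofIdeal_eq_vOp hQ, hQ0⟩
    refine ⟨s, hs, ?_⟩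
    rw [mul_comm, ← mul_smul_comm]
    exact hw _ hsx

theorem one_eq_iInf_of_vSp_one_eq (hP : IsPruferDomain D) (hH : IsHLocal D)
    (h : vSp (1 : Submodule D K) = 1) : (1 : Submodule D K) =
      ⨅ Q ∈ {Q : PrimeSpectrum D | ofIdeal K Q.asIdeal = vOp (ofIdeal K Q.asIdeal)},
        localizationAt K Q := by
  refine le_antisymm (le_iInf₂ fun Q _ x hx => ?_) ?_
  · exact mem_localizationAt.mpr ⟨1, (Ideal.ne_top_iff_one _).mp Q.isPrime.ne_top, by simpa using hx⟩
  · conv_rhs => rw [← h, vSp]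
    refine le_iInf₂ fun Q hQ => ?_
    rw [one_mul]
    exact iInf₂_le Q (ofIdeal_eq_vOp_of_vOp_ne_one hP hH hQ.1)

/-- If no divisorial prime contains `I`, then `I` meets the complement of every prime in `Π^v`, so
`1 ∈ I^{v_sp} ⊆ I^v`. -/
theorem quasiSpectralV_of_vSp_le_vOp (hP : IsPruferDomain D) (hH : IsHLocal D)
    (h : ∀ E : Submodule D K, E ≠ ⊥ → vSp E ≤ vOp E) : QuasiSpectralV D K := by
  intro I hI0 hIv
  by_contra! hcon
  refine hIv (vOp_ofIdeal_eq_one_iff.mpr (h _ ?_ (mem_vSp.mpr fun Q hQ => ?_)))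
  · obtain ⟨a, ha, ha0⟩ := Submodule.exists_mem_ne_zero_of_ne_bot hI0
    exact fun hbot => (map_ne_zero_iff _ (IsFractionRing.injective D K)).mpr ha0
      ((Submodule.eq_bot_iff _).mp hbot _ (algebraMap_mem_ofIdeal.mpr ha))
  · obtain ⟨s, hs, hsQ⟩ := SetLike.not_le_iff_exists.mp fun hIQ =>
      hcon Q hIQ (ofIdeal_eq_vOp_of_vOp_ne_one hP hH hQ.1)
    exact ⟨s, hsQ, by rw [← Algebra.algebraMap_eq_smul_one]; exact algebraMap_mem_ofIdeal.mpr hs⟩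

end Semistar

theorem mainTheorem8 (D : Type*) [CommRing D] [IsDomain D]
    (K : Type*) [Field K] [Algebra D K] [IsFractionRing D K]
    (hP : IsPruferDomain D) (hH : IsHLocal D) :
    (∀ E : Submodule D K, Semistar.IsNonzeroFractional E → Semistar.vBar E = Semistar.vOp E) ∧
    List.TFAE [
      Semistar.QuasiSpectralV D K,
      ∀ E : Submodule D K, E ≠ ⊥ → Semistar.vSp E ≤ Semistar.vOp E,
      (1 : Submodule D K) =
        ⨅ Q ∈ {Q : PrimeSpectrum D |
          Semistar.ofIdeal K Q.asIdeal = Semistar.vOp (Semistar.ofIdeal K Q.asIdeal)},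
          Semistar.localizationAt K Q,
      (∀ E : Submodule D K, E ≠ ⊥ → Semistar.vBar E = Semistar.vSp E) ∧
        (∀ E : Submodule D K, Semistar.IsNonzeroFractional E →
          Semistar.vSp E = Semistar.vOp E),
      Semistar.localizingSystemV K =
        Semistar.localizingSystemOfPrimes (Semistar.primesV (D := D) K)] := by
  refine ⟨fun E hE => Semistar.vBar_eq_vOp hP hH hE.2, ?_⟩
  tfae_have 1 → 5 := fun h => h.localizingSystemV_eq
  tfae_have 5 → 4 := fun h => ⟨fun E _ => Semistar.vBar_eq_vSp h E, fun E hE => by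
    rw [← Semistar.vBar_eq_vSp h, Semistar.vBar_eq_vOp hP hH hE.2]⟩
  tfae_have 4 → 3 := fun h => Semistar.one_eq_iInf_of_vSp_one_eq hP hH <| by
    rw [h.2 1 ⟨one_ne_zero, FractionalIdeal.isFractional_of_le_one _ le_rfl⟩, Semistar.vOp_one]
  tfae_have 3 → 2 := fun h E _ => Semistar.vSp_le_vOp_of_one_eq h E
  tfae_have 2 → 1 := Semistar.quasiSpectralV_of_vSp_le_vOp hP hH
  tfae_finish
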